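/- Theorem 4.5. All graphs are finite, simple and undirected, and $A(G)$ denotes the adjacency matrix of $G$. The neighborhood corona $G_1\bigstar G_2$ is the graph with vertex set $V(G_1)\times(\{0\}\cup V(G_2))$, where $0\notin V(G_2)$, in which $(x,y)$ and $(x',y')$ are adjacent if and only if one of the following holds: $y=y'=0$ and $xx'\in E(G_1)$; or $x=x'$, $y,y'\in V(G_2)$ and $yy'\in E(G_2)$; or $xx'\in E(G_1)$ and exactly one of $y,y'$ is $0$. The eigenvalue support $\mathrm{supp}_G(v)$ of a vertex $v$ is the set of eigenvalues $\lambda$ of $A(G)$ such that the orthogonal projection of the characteristic vector $e_v$ onto the eigenspace of $\lambda$ is non-zero. The graph $G$ is periodic at $v$ if there are $t>0$ and $\gamma\in\mathbb{C}$ with $|\gamma|=1$ such that $\exp(-itA(G))e_v=\gamma e_v$. Let $G_1$ be a connected graph, let $G_2$ be a connected $k$-regular graph (for some integer $k\ge 0$), and let $v\in V(G_1)$. Suppose that there are a non-zero $\lambda\in\mathrm{supp}_{G_1}(v)$ and a square-free integer $\Delta'>1$ such that $\lambda\in\mathbb{Z}\sqrt{\Delta'}$, that is, $\lambda=m\sqrt{\Delta'}$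 for some integer $m$. Then, for every $w\in V(G_2)\cup\{0\}$, the graph $G_1\bigstar G_2$ is not periodic at $(v,w)$. -/

import Mathlib

/-- The neighborhood corona of `G₁` and `G₂` on `V(G₁) × ({0} ∪ V(G₂))`, where `none` plays the
role of `0`: one copy of `G₁` (the vertices `(x, none)`), one copy of `G₂` for each vertex `x` of
`G₁` (the vertices `(x, some y)`), and every neighbour of `x` in `G₁` is joined to all vertices of
the copy of `G₂` attached to `x`. -/
def neighborhoodCorona {V₁ V₂ : Type*} (G₁ : SimpleGraph V₁) (G₂ : SimpleGraph V₂) :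
    SimpleGraph (V₁ × Option V₂) where
  Adj p q :=
    match p, q with
    | (x, none), (x', none) => G₁.Adj x x'
    | (x, some y), (x', some y') => x = x' ∧ G₂.Adj y y'
    | (x, none), (x', some _) => G₁.Adj x x'
    | (x, some _), (x', none) => G₁.Adj x x'
  symm := ⟨by
    rintro ⟨x, _ | y⟩ ⟨x', _ | y'⟩ h
    · exact G₁.adj_symm h
    · exact G₁.adj_symm h
    · exact G₁.adj_symm h
    · exact ⟨h.1.symm, G₂.adj_symm h.2⟩⟩
  loopless := ⟨by
    rintro ⟨x, _ | y⟩ h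
    · exact G₁.irrefl h
    · exact G₂.irrefl h.2⟩

instance neighborhoodCorona.instDecidableRelAdj {V₁ V₂ : Type*} [DecidableEq V₁]
    (G₁ : SimpleGraph V₁) (G₂ : SimpleGraph V₂) [DecidableRel G₁.Adj] [DecidableRel G₂.Adj] :
    DecidableRel (neighborhoodCorona G₁ G₂).Adj
  | (x, none), (x', none) => inferInstanceAs (Decidable (G₁.Adj x x'))
  | (x, some y), (x', some y') => inferInstanceAs (Decidable (x = x' ∧ G₂.Adj y y'))
  | (x, none), (x', some _) => inferInstanceAs (Decidable (G₁.Adj x x'))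
  | (x, some _), (x', none) => inferInstanceAs (Decidable (G₁.Adj x x'))

/-- The eigenprojector of the adjacency matrix of `G` at `μ`: the orthogonal projection of
`ℝ ^ V` onto the eigenspace of `A(G)` for `μ` (this is zero if `μ` is not an eigenvalue). -/
noncomputable def eigenprojector {V : Type*} [Fintype V] [DecidableEq V] (G : SimpleGraph V)
    [DecidableRel G.Adj] (μ : ℝ) : EuclideanSpace ℝ V →L[ℝ] EuclideanSpace ℝ V :=
  (Module.End.eigenspace (Matrix.toEuclideanLin (G.adjMatrix ℝ)) μ).starProjection

/-- The eigenvalue support of `v` in `G`: the eigenvalues of the adjacency matrix whose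
eigenprojector does not annihilate the characteristic vector of `v`. -/
def eigenvalueSupport {V : Type*} [Fintype V] [DecidableEq V] (G : SimpleGraph V)
    [DecidableRel G.Adj] (v : V) : Set ℝ :=
  {μ | Module.End.HasEigenvalue (Matrix.toEuclideanLin (G.adjMatrix ℝ)) μ ∧
    eigenprojector G μ (EuclideanSpace.single v 1) ≠ 0}

/-- The transition matrix `exp(-itA(G))` of the continuous-time quantum walk on `G`. -/
noncomputable def transitionMatrix {V : Type*} [Fintype V] [DecidableEq V] (G : SimpleGraph V)
    [DecidableRel G.Adj] (t : ℝ) : Matrix V V ℂ :=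
  NormedSpace.exp ((-(Complex.I * (t : ℂ))) • G.adjMatrix ℂ)

/-- `G` is periodic at `v`: at some time `t > 0` the transition matrix maps the characteristic
vector of `v` to a unimodular multiple of itself. -/
def IsPeriodicAt {V : Type*} [Fintype V] [DecidableEq V] (G : SimpleGraph V)
    [DecidableRel G.Adj] (v : V) : Prop :=
  ∃ t : ℝ, 0 < t ∧ ∃ γ : ℂ, ‖γ‖ = 1 ∧
    (transitionMatrix G t).mulVec (Pi.single v 1) = γ • (Pi.single v 1 : V → ℂ)

open Matrix in
/-- The exponential of a matrix acts on an eigenvector by the exponential of its eigenvalue. -/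
theorem exp_mulVec_of_mulVec_eq_smul {V : Type*} [Fintype V] [DecidableEq V]
    {A : Matrix V V ℂ} {u : V → ℂ} {c : ℂ} (h : A *ᵥ u = c • u) :
    NormedSpace.exp A *ᵥ u = Complex.exp c • u := by
  have hpow : ∀ n : ℕ, (A ^ n) *ᵥ u = c ^ n • u := by
    intro n
    induction n with
    | zero => simp
    | succ n ih =>
      rw [pow_succ', ← Matrix.mulVec_mulVec, ih, Matrix.mulVec_smul, h, smul_smul, pow_succ]
  have hA : HasSum (fun n : ℕ => ((n.factorial : ℂ)⁻¹) • A ^ n) (NormedSpace.exp A) := by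
    open scoped Matrix.Norms.Operator in
    exact NormedSpace.exp_series_hasSum_exp' (𝕂 := ℂ) A
  have hc : HasSum (fun n : ℕ => ((n.factorial : ℂ)⁻¹) • c ^ n) (Complex.exp c) := by
    rw [Complex.exp_eq_exp_ℂ]
    exact NormedSpace.exp_series_hasSum_exp' (𝕂 := ℂ) c
  have h₁ := hA.map (Matrix.mulVec.addMonoidHomLeft u)
    (continuous_id.matrix_mulVec continuous_const)
  have h₂ := hc.smul_const u
  refine h₁.unique (h₂.congr_fun ?_)
  intro n
  simp [Matrix.mulVec.addMonoidHomLeft, Matrix.smul_mulVec, hpow, smul_smul]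

open Matrix in
/-- If `G` is periodic at `p`, any two eigenvalues having eigenvectors that do not vanish at `p`
differ by an integer multiple of a fixed real number. -/
theorem IsPeriodicAt.exists_sub_eq_intCast_mul {V : Type*} [Fintype V] [DecidableEq V]
    {G : SimpleGraph V} [DecidableRel G.Adj] {p : V} (h : IsPeriodicAt G p) :
    ∃ c : ℝ, ∀ (a b : ℝ) (x y : V → ℝ), G.adjMatrix ℝ *ᵥ x = a • x → x p ≠ 0 →
      G.adjMatrix ℝ *ᵥ y = b • y → y p ≠ 0 → ∃ n : ℤ, a - b = n * c := by
  obtain ⟨t, ht, γ, -, hγ⟩ := h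
  have key : ∀ (a : ℝ) (x : V → ℝ), G.adjMatrix ℝ *ᵥ x = a • x → x p ≠ 0 →
      Complex.exp (-(Complex.I * t) * a) = γ := by
    intro a x hx hxp
    set u : V → ℂ := fun i => (x i : ℂ) with hu
    have hA : G.adjMatrix ℂ *ᵥ u = (a : ℂ) • u := by
      ext i
      have := congrFun hx i
      simp only [SimpleGraph.adjMatrix_mulVec_apply, Pi.smul_apply, smul_eq_mul] at this ⊢
      simp only [hu]
      exact_mod_cast this
    have hB : ((-(Complex.I * (t : ℂ))) • G.adjMatrix ℂ) *ᵥ u = (-(Complex.I * t) * a) • u := by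
      rw [Matrix.smul_mulVec, hA, smul_smul]
    have hU := exp_mulVec_of_mulVec_eq_smul hB
    have hsymm : (transitionMatrix G t).IsSymm :=
      Matrix.IsSymm.exp ((SimpleGraph.isSymm_adjMatrix G).smul _)
    have hdot : u ⬝ᵥ ((transitionMatrix G t) *ᵥ Pi.single p 1) =
        ((transitionMatrix G t) *ᵥ u) ⬝ᵥ Pi.single p 1 := by
      rw [Matrix.dotProduct_mulVec, ← Matrix.mulVec_transpose, hsymm.eq]
    rw [hγ] at hdot
    unfold transitionMatrix at hdot
    rw [hU] at hdot
    simp only [dotProduct_smul, dotProduct_single, mul_one, smul_eq_mul] at hdot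
    have hup : u p ≠ 0 := by simpa [hu] using hxp
    exact (mul_right_cancel₀ hup hdot).symm
  refine ⟨2 * Real.pi / t, fun a b x y hx hxp hy hyp => ?_⟩
  obtain ⟨n, hn⟩ := Complex.exp_eq_exp_iff_exists_int.mp ((key b y hy hyp).trans (key a x hx hxp).symm)
  refine ⟨n, ?_⟩
  have hI := congrArg Complex.im hn
  simp at hI
  field_simp
  linarith

/-- A real number `θ` with `θ ∉ ℚ` and `θ² ∈ ℚ` admits an additive map of `ℝ` extending the
conjugation of `ℚ(θ)`. -/
theorem exists_addMonoidHom_conj {θ : ℝ} (hθ : Irrational θ) {q : ℚ} (hq : θ ^ 2 = q) :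
    ∃ σ : ℝ →+ ℝ, σ 1 = 1 ∧ ∀ x, σ (θ * x) = -θ * σ x := by
  have hθ0 : θ ≠ 0 := hθ.ne_zero
  have h1 : (1 : ℝ) ∉ Submodule.span ℚ {θ} := by
    rw [Submodule.mem_span_singleton]
    rintro ⟨r, hr⟩
    rw [Rat.smul_def] at hr
    refine hθ ⟨r⁻¹, ?_⟩
    rw [Rat.cast_inv]
    exact inv_eq_of_mul_eq_one_right hr
  obtain ⟨g, hg1, hg⟩ := Submodule.exists_le_ker_of_notMem h1
  have hgθ : g θ = 0 := hg (Submodule.mem_span_singleton_self θ)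
  let f : ℝ →ₗ[ℚ] ℚ := (g 1)⁻¹ • g
  have hf1 : f 1 = 1 := by simp [f, hg1]
  have hfθ : f θ = 0 := by simp [f, hgθ]
  have hfq : ∀ x, f (θ * (θ * x)) = q * f x := by
    intro x
    have : θ * (θ * x) = q • x := by rw [Rat.smul_def, ← hq]; ring
    rw [this, map_smul, smul_eq_mul]
  refine ⟨{ toFun := fun x => f x - f (θ * x) / θ, map_zero' := by simp, map_add' := ?_ }, ?_, ?_⟩
  · intro x y
    simp only [mul_add, map_add]
    push_cast
    ring
  · simp [hf1, hfθ]
  · intro x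
    simp only [AddMonoidHom.coe_mk, ZeroHom.coe_mk, hfq]
    push_cast
    rw [← hq]
    field_simp
    ring

open Matrix in
/-- An element of the eigenvalue support of `v` has an eigenvector that does not vanish at `v`. -/
theorem exists_eigenvector_of_mem_eigenvalueSupport {V : Type*} [Fintype V] [DecidableEq V]
    {G : SimpleGraph V} [DecidableRel G.Adj] {v : V} {μ : ℝ} (h : μ ∈ eigenvalueSupport G v) :
    ∃ x : V → ℝ, G.adjMatrix ℝ *ᵥ x = μ • x ∧ x v ≠ 0 := by
  obtain ⟨-, h⟩ := h
  unfold eigenprojector at h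
  set W := Module.End.eigenspace (Matrix.toEuclideanLin (G.adjMatrix ℝ)) μ
  set y := W.starProjection (EuclideanSpace.single v 1) with hy
  have hyW : y ∈ W := W.starProjection_apply_mem _
  refine ⟨WithLp.ofLp y, ?_, fun hv => h ?_⟩
  · have := Module.End.mem_eigenspace_iff.mp hyW
    have := congrArg WithLp.ofLp this
    simpa using this
  · have h0 : inner ℝ y (EuclideanSpace.single v (1 : ℝ)) = 0 := by
      simp [EuclideanSpace.inner_single_right, hv]
    have : inner ℝ y y = 0 := by
      conv_lhs => rw [hy]
      rw [W.inner_starProjection_left_eq_right, ← hy,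
        Submodule.starProjection_eq_self_iff.mpr hyW, real_inner_comm, h0]
    exact inner_self_eq_zero.mp this

open Matrix in
/-- If a quadratic irrationality `θ` with `θ² ∈ ℚ` is an eigenvalue of a graph with an eigenvector
that does not vanish at `v`, then so is `-θ`. -/
theorem exists_eigenvector_neg {V : Type*} [Fintype V] [DecidableEq V]
    {G : SimpleGraph V} [DecidableRel G.Adj] {v : V} {θ : ℝ} (hθ : Irrational θ) {q : ℚ}
    (hq : θ ^ 2 = q) {x : V → ℝ} (hx : G.adjMatrix ℝ *ᵥ x = θ • x) (hxv : x v ≠ 0) :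
    ∃ y : V → ℝ, G.adjMatrix ℝ *ᵥ y = (-θ) • y ∧ y v ≠ 0 := by
  by_contra! hcon
  obtain ⟨σ, hσ1, hσ⟩ := exists_addMonoidHom_conj hθ hq
  set T := Matrix.toEuclideanLin (G.adjMatrix ℝ + θ • (1 : Matrix V V ℝ)) with hT
  have hTs : T.IsSymmetric := by
    rw [hT, Matrix.isSymmetric_toEuclideanLin_iff]
    refine Matrix.IsHermitian.add ?_ ?_
    · simp [Matrix.IsHermitian]
    · simp [Matrix.IsHermitian]
  have hmem : EuclideanSpace.single v (1 : ℝ) ∈ LinearMap.range T := by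
    rw [← Submodule.orthogonal_orthogonal (LinearMap.range T), hTs.orthogonal_range,
      Submodule.mem_orthogonal]
    intro y hy
    have h0 := congrArg WithLp.ofLp (LinearMap.mem_ker.mp hy)
    have := hcon (WithLp.ofLp y) (by
      simp only [hT, Matrix.toEuclideanLin, Matrix.ofLp_toLpLin, Matrix.toLin'_apply,
        Matrix.add_mulVec, Matrix.smul_mulVec, Matrix.one_mulVec, WithLp.ofLp_zero] at h0
      rw [neg_smul]
      exact eq_neg_of_add_eq_zero_left h0)
    simp [EuclideanSpace.inner_single_right, this]
  obtain ⟨z, hz⟩ := hmem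
  have hz' : G.adjMatrix ℝ *ᵥ WithLp.ofLp z + θ • WithLp.ofLp z = Pi.single v 1 := by
    have := congrArg WithLp.ofLp hz
    simpa [hT, Matrix.add_mulVec, Matrix.smul_mulVec] using this
  set s : V → ℝ := fun i => σ (z i) with hs
  have hs' : G.adjMatrix ℝ *ᵥ s - θ • s = Pi.single v 1 := by
    ext i
    have h := congrArg σ (congrFun hz' i)
    simp only [Pi.add_apply, SimpleGraph.adjMatrix_mulVec_apply, Pi.smul_apply, smul_eq_mul,
      map_add, map_sum, hσ] at h
    simp only [Pi.sub_apply, SimpleGraph.adjMatrix_mulVec_apply, Pi.smul_apply, smul_eq_mul, hs]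
    rw [sub_eq_add_neg, ← neg_mul, h]
    by_cases hi : i = v
    · subst hi; simp [hσ1]
    · simp [hi]
  have hdot : x ⬝ᵥ (G.adjMatrix ℝ *ᵥ s) = (G.adjMatrix ℝ *ᵥ x) ⬝ᵥ s := by
    rw [Matrix.dotProduct_mulVec, ← Matrix.mulVec_transpose, (SimpleGraph.isSymm_adjMatrix G).eq]
  apply hxv
  have h := congrArg (fun w => x ⬝ᵥ w) hs'
  simp only [dotProduct_sub, hdot, hx, smul_dotProduct, dotProduct_smul, sub_self,
    dotProduct_single, mul_one] at h
  exact h.symm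

open Matrix in
/-- Eigenvectors of a neighborhood corona with a regular graph that are constant on each copy of
the second factor. -/
theorem neighborhoodCorona_adjMatrix_mulVec {V₁ V₂ : Type*} [Fintype V₁] [DecidableEq V₁]
    [Fintype V₂] [DecidableEq V₂] {G₁ : SimpleGraph V₁} [DecidableRel G₁.Adj]
    {G₂ : SimpleGraph V₂} [DecidableRel G₂.Adj] {k : ℕ} (hk : G₂.IsRegularOfDegree k)
    {θ l : ℝ} (hl : (l - k) * (l - θ) = Fintype.card V₂ * θ ^ 2) {x : V₁ → ℝ}
    (hx : G₁.adjMatrix ℝ *ᵥ x = θ • x) :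
    (neighborhoodCorona G₁ G₂).adjMatrix ℝ *ᵥ
        (fun p => p.2.elim (l - k) (fun _ => θ) * x p.1) =
      l • fun p => p.2.elim (l - k) (fun _ => θ) * x p.1 := by
  have hx' : ∀ i, ∑ j, (if G₁.Adj i j then x j else 0) = θ * x i := by
    intro i
    have := congrFun hx i
    simpa [Matrix.mulVec, dotProduct, SimpleGraph.adjMatrix_apply] using this
  have hk' : ∀ y, ∑ j, (if G₂.Adj y j then (1 : ℝ) else 0) = k := by
    intro y
    rw [← hk y, ← SimpleGraph.card_neighborFinset_eq_degree, SimpleGraph.neighborFinset_eq_filter]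
    simp
  have e : ∀ (i : V₁) (c : ℝ), ∑ j, (if G₁.Adj i j then c * x j else 0) = c * (θ * x i) := by
    intro i c
    rw [← hx', Finset.mul_sum]
    simp
  have hnn : ∀ i j, (neighborhoodCorona G₁ G₂).Adj (i, none) (j, none) ↔ G₁.Adj i j :=
    fun _ _ => Iff.rfl
  have hns : ∀ i j z, (neighborhoodCorona G₁ G₂).Adj (i, none) (j, some z) ↔ G₁.Adj i j :=
    fun _ _ _ => Iff.rfl
  have hsn : ∀ i j z, (neighborhoodCorona G₁ G₂).Adj (i, some z) (j, none) ↔ G₁.Adj i j :=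
    fun _ _ _ => Iff.rfl
  have hss : ∀ i j z z', (neighborhoodCorona G₁ G₂).Adj (i, some z) (j, some z') ↔
      i = j ∧ G₂.Adj z z' := fun _ _ _ _ => Iff.rfl
  ext ⟨i, _ | y⟩
  · simp only [Matrix.mulVec, dotProduct, SimpleGraph.adjMatrix_apply, Fintype.sum_prod_type,
      Fintype.sum_option, Option.elim, ite_mul, one_mul, zero_mul, Pi.smul_apply, smul_eq_mul,
      Finset.sum_add_distrib, hnn, hns]
    rw [e, Finset.sum_comm]
    simp only [e, Finset.sum_const, Finset.card_univ, nsmul_eq_mul]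
    linear_combination (-x i) * hl
  · simp only [Matrix.mulVec, dotProduct, SimpleGraph.adjMatrix_apply, Fintype.sum_prod_type,
      Fintype.sum_option, Option.elim, ite_mul, one_mul, zero_mul, Pi.smul_apply, smul_eq_mul,
      Finset.sum_add_distrib, hsn, hss]
    have h2 : ∑ j, ∑ y', (if i = j ∧ G₂.Adj y y' then θ * x j else 0) = k * (θ * x i) := by
      simp only [ite_and]
      rw [Finset.sum_comm]
      simp only [Finset.sum_ite_eq, Finset.mem_univ, if_true]
      rw [← hk' y, Finset.sum_mul]
      simp
    rw [e, h2]
    ring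

/-- If `θ` is an irrational eigenvalue of `G₁` with `θ² ∈ ℚ` that has an eigenvector not vanishing
at `v`, then no neighborhood corona of `G₁` with a connected regular graph is periodic at a vertex
`(v, w)`. -/
theorem not_isPeriodicAt_neighborhoodCorona {V₁ V₂ : Type*} [Fintype V₁] [DecidableEq V₁]
    [Fintype V₂] [DecidableEq V₂] {G₁ : SimpleGraph V₁} [DecidableRel G₁.Adj]
    {G₂ : SimpleGraph V₂} [DecidableRel G₂.Adj] (hG₂ : G₂.Connected) {k : ℕ}
    (hk : G₂.IsRegularOfDegree k) {v : V₁} {θ : ℝ} (hθ : Irrational θ) {q : ℚ}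
    (hq : θ ^ 2 = q) {x : V₁ → ℝ} (hx : (G₁.adjMatrix ℝ).mulVec x = θ • x) (hxv : x v ≠ 0)
    (w : Option V₂) : ¬ IsPeriodicAt (neighborhoodCorona G₁ G₂) (v, w) := by
  intro hper
  obtain ⟨c, hc⟩ := hper.exists_sub_eq_intCast_mul
  obtain ⟨y, hy, hyv⟩ := exists_eigenvector_neg hθ hq hx hxv
  have := hG₂.nonempty
  set n := Fintype.card V₂ with hn
  have hn0 : (0 : ℝ) < n := by exact_mod_cast Fintype.card_pos
  have hθ0 : θ ≠ 0 := hθ.ne_zero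
  have hθ2 : 0 < n * θ ^ 2 := by positivity
  have hroot : ∀ (a l : ℝ), a ^ 2 = θ ^ 2 → (l - k) * (l - a) = n * a ^ 2 →
      w.elim (l - k) (fun _ => a) ≠ 0 := by
    intro a l ha hl
    rw [ha] at hl
    cases w with
    | none =>
      intro h
      simp only [Option.elim] at h
      rw [h, zero_mul] at hl
      exact hθ2.ne hl
    | some _ =>
      intro h
      simp only [Option.elim] at h
      rw [h] at ha
      exact hθ0 (by simpa using ha.symm)
  set D := √((θ - k) ^ 2 + 4 * n * θ ^ 2) with hD
  set E := √((θ + k) ^ 2 + 4 * n * θ ^ 2) with hE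
  have hD2 : D ^ 2 = (θ - k) ^ 2 + 4 * n * θ ^ 2 := Real.sq_sqrt (by positivity)
  have hE2 : E ^ 2 = (θ + k) ^ 2 + 4 * n * θ ^ 2 := Real.sq_sqrt (by positivity)
  have hdiff : ∀ (a b l l' : ℝ) (x y : V₁ → ℝ), a ^ 2 = θ ^ 2 → b ^ 2 = θ ^ 2 →
      (l - k) * (l - a) = n * a ^ 2 → (l' - k) * (l' - b) = n * b ^ 2 →
      (G₁.adjMatrix ℝ).mulVec x = a • x → x v ≠ 0 → (G₁.adjMatrix ℝ).mulVec y = b • y →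
      y v ≠ 0 → ∃ N : ℤ, l - l' = N * c := by
    intro a b l l' x y ha hb hl hl' hx hxv hy hyv
    exact hc l l' _ _ (neighborhoodCorona_adjMatrix_mulVec hk hl hx)
      (mul_ne_zero (hroot a l ha hl) hxv) (neighborhoodCorona_adjMatrix_mulVec hk hl' hy)
      (mul_ne_zero (hroot b l' hb hl') hyv)
  have r1 : ((k + θ + D) / 2 - k) * ((k + θ + D) / 2 - θ) = n * θ ^ 2 := by
    linear_combination hD2 / 4
  have r2 : ((k + θ - D) / 2 - k) * ((k + θ - D) / 2 - θ) = n * θ ^ 2 := by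
    linear_combination hD2 / 4
  have r3 : ((k - θ + E) / 2 - k) * ((k - θ + E) / 2 - -θ) = n * (-θ) ^ 2 := by
    linear_combination hE2 / 4
  have r4 : ((k - θ - E) / 2 - k) * ((k - θ - E) / 2 - -θ) = n * (-θ) ^ 2 := by
    linear_combination hE2 / 4
  obtain ⟨N₁, h₁⟩ := hdiff θ θ _ _ x x rfl rfl r1 r2 hx hxv hx hxv
  obtain ⟨N₂, h₂⟩ := hdiff θ (-θ) _ _ x y rfl (by ring) r1 r3 hx hxv hy hyv
  obtain ⟨N₃, h₃⟩ := hdiff θ (-θ) _ _ x y rfl (by ring) r2 r4 hx hxv hy hyv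
  have hDc : D = N₁ * c := by linear_combination h₁
  have hθc : 2 * θ = (N₂ + N₃ : ℤ) * c := by push_cast; linear_combination h₂ + h₃
  have hM : ((N₂ + N₃ : ℤ) : ℝ) ≠ 0 := by
    intro h
    rw [h, zero_mul] at hθc
    exact hθ0 (by linarith)
  set r : ℚ := 2 * N₁ / (N₂ + N₃ : ℤ) with hr
  have hrD : D = r * θ := by
    rw [hDc, hr]
    push_cast at hM hθc ⊢
    field_simp
    linear_combination (-(N₁ : ℝ)) * hθc
  have hkr : 2 * k * θ = ((k ^ 2 + (4 * n + 1) * q - r ^ 2 * q : ℚ) : ℝ) := by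
    push_cast
    rw [← hq]
    rw [hrD] at hD2
    linear_combination hD2
  have hk0 : k = 0 := by
    by_contra hk0
    refine hθ ⟨(k ^ 2 + (4 * n + 1) * q - r ^ 2 * q) / (2 * k), ?_⟩
    have : (k : ℝ) ≠ 0 := by exact_mod_cast hk0
    rw [Rat.cast_div, ← hkr]
    push_cast
    field_simp
  have hn1 : n = 1 := by
    by_contra hne
    have : Nontrivial V₂ := Fintype.one_lt_card_iff_nontrivial.mp
      (lt_of_le_of_ne Fintype.card_pos (Ne.symm hne))
    have hpos := hG₂.preconnected.degree_pos_of_nontrivial (Classical.arbitrary V₂)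
    rw [hk, hk0] at hpos
    exact lt_irrefl _ hpos
  have h5 : (r : ℝ) ^ 2 = 5 := by
    rw [hrD, hk0, hn1] at hD2
    have : θ ^ 2 ≠ 0 := pow_ne_zero 2 hθ0
    refine mul_right_cancel₀ this ?_
    push_cast at hD2
    linear_combination hD2
  have hirr : Irrational (√5) := by
    simpa using Nat.Prime.irrational_sqrt (p := 5) (by norm_num)
  refine hirr ⟨|r|, ?_⟩
  rw [← h5, Real.sqrt_sq_eq_abs, Rat.cast_abs]

theorem theorem4p5 {V₁ V₂ : Type*} [Fintype V₁] [DecidableEq V₁] [Fintype V₂] [DecidableEq V₂]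
    (G₁ : SimpleGraph V₁) [DecidableRel G₁.Adj] (G₂ : SimpleGraph V₂) [DecidableRel G₂.Adj]
    (hG₁ : G₁.Connected) (hG₂ : G₂.Connected) (k : ℕ) (hk : G₂.IsRegularOfDegree k)
    (v : V₁)
    (hv : ∃ μ ∈ eigenvalueSupport G₁ v, μ ≠ 0 ∧
      ∃ Δ : ℤ, 1 < Δ ∧ Squarefree Δ ∧ ∃ m : ℤ, μ = (m : ℝ) * Real.sqrt (Δ : ℝ))
    (w : Option V₂) :
    ¬ IsPeriodicAt (neighborhoodCorona G₁ G₂) (v, w) := by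
  obtain ⟨μ, hμ, hμ0, Δ, hΔ1, hΔ, m, rfl⟩ := hv
  obtain ⟨x, hx, hxv⟩ := exists_eigenvector_of_mem_eigenvalueSupport hμ
  have hm : m ≠ 0 := by
    rintro rfl
    simp at hμ0
  have hsq : ¬ IsSquare Δ := by
    rintro ⟨d, hd⟩
    have hu := hΔ d ⟨1, by rw [hd, mul_one]⟩
    rw [hd, Int.isUnit_mul_self hu] at hΔ1
    exact lt_irrefl _ hΔ1
  have hirr : Irrational ((m : ℝ) * √(Δ : ℝ)) :=
    ((irrational_sqrt_intCast_iff_of_nonneg (by omega)).mpr hsq).intCast_mul hm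
  refine not_isPeriodicAt_neighborhoodCorona hG₂ hk hirr (q := m ^ 2 * Δ) ?_ hx hxv w
  have : (0 : ℝ) ≤ Δ := by exact_mod_cast (by omega : (0 : ℤ) ≤ Δ)
  rw [mul_pow, Real.sq_sqrt this]
  push_cast
  rfl
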